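/- A \emph{non-commutative probability space} is a pair $(\mathcal A,\varphi)$ consisting of a unital complex algebra $\mathcal A$ and a linear map $\varphi:\mathcal A\to\mathbb C$ with $\varphi(1)=1$. Elements $a_1,\dots,a_d\in\mathcal A$ are \emph{freely independent} if, writing $\mathcal A_i$ for the unital subalgebra generated by $a_i$, one has $\varphi(x_1\cdots x_r)=0$ whenever $r\ge 2$, $x_k\in\mathcal A_{j_k}$, $\varphi(x_k)=0$ for all $k$, and $j_1\ne j_2,\ j_2\neq j_3,\dots,\ j_{r-1}\ne j_r$. A \emph{spectral distribution} of $a\in\mathcal A$ is a probability measure $\mu$ on $\mathbb R$ all of whose moments exist and which satisfies $\varphi(a^n)=\int_{\mathbb R}x^n\,d\mu(x)$ for all $n\ge 0$. \textbf{Proposition.} Let $1\le d<\infty$ and let $a_1,\dots,a_d$ be freely independent elements of a non-commutative probability space $(\mathcal A,\varphi)$ such that each $a_i$ has a spectral distribution $\mu_i$ whose support is not compact. Then the sum $a=a_1+\cdots+a_d$ also has non-compact spectrum: $a$ has a spectral distribution, and every spectral distribution of $a$ has non-compact support. -/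

import Mathlib

open MeasureTheory

/-- Unital subalgebras `S i` of a non-commutative probability space `(A, φ)` are freely independent:
`φ (x₁ ⋯ x_r) = 0` whenever `r ≥ 2`, each factor is centred (`φ (x_k) = 0`) and lies in one of the
subalgebras (`x_k ∈ S (j_k)`), and neighbouring factors come from different subalgebras. -/
def FreelyIndependentSubalgebras {A : Type*} [Ring A] [Algebra ℂ A] (φ : A →ₗ[ℂ] ℂ)
    {ι : Type*} (S : ι → Subalgebra ℂ A) : Prop :=
  ∀ (r : ℕ), 2 ≤ r → ∀ (j : Fin r → ι) (x : Fin r → A),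
    (∀ k, x k ∈ S (j k)) → (∀ k, φ (x k) = 0) →
    (∀ k l : Fin r, (l : ℕ) = (k : ℕ) + 1 → j k ≠ j l) →
    φ (List.ofFn x).prod = 0

/-- Random variables are freely independent if the unital subalgebras they generate are. -/
def FreelyIndependent {A : Type*} [Ring A] [Algebra ℂ A] (φ : A →ₗ[ℂ] ℂ)
    {ι : Type*} (a : ι → A) : Prop :=
  FreelyIndependentSubalgebras φ fun i => Algebra.adjoin ℂ {a i}

/-- `μ` is a spectral distribution of the random variable `a`: a probability measure on the real
line, all of whose moments exist, with `φ (a ^ n) = ∫ x ^ n dμ(x)` for every `n`. -/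
structure IsSpectralDistribution {A : Type*} [Ring A] [Algebra ℂ A] (φ : A →ₗ[ℂ] ℂ) (a : A)
    (μ : Measure ℝ) : Prop where
  isProbabilityMeasure : IsProbabilityMeasure μ
  integrable_pow : ∀ n : ℕ, Integrable (fun x : ℝ => x ^ n) μ
  moment_eq : ∀ n : ℕ, φ (a ^ n) = ((∫ x : ℝ, x ^ n ∂μ : ℝ) : ℂ)

/-! The variables are modelled by symmetric operators on the algebraic free product of the
polynomial spaces in L²(μ_i). Non-compact support means infinite support, so the L² product on
polynomials is definite and there are orthonormal polynomials of every degree. Reduced words in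
these polynomials are taken as an orthonormal basis. Freeness identifies `φ` with the vector state
of the empty word `e`, and the sum of the variables with a symmetric operator `J`.

Existence is Hamburger's theorem: compressing `J` to the span of e, Je, ..., J^N e gives a finite
spectral measure with the right first N moments, and tightness gives a limit
(`LinearMap.IsSymmetric.exists_measure_moments`).

For non-compactness, suppose that a spectral distribution of the sum lives on [-M, M]. Then ‖Jⁿe‖ ≤
Mⁿ. Since `φ` is tracial on the free product (`FreelyIndependentSubalgebras.apply_mul_comm`), ‖Jⁿ
p(a_1)e‖² = φ(p(a_1)² a^(2n)) grows at most like M^(2n), and log-convexity in n forces ‖Jv‖ ≤ M‖v‖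
for v = p(a_1)e. By freeness, `J` compressed to polynomials in a_1 is multiplication by x + c, with
c the sum of the other means. So this multiplication is bounded by M, the moments of x + c grow
geometrically, and μ_1 has compact support, a contradiction. -/

open Filter Topology
open scoped InnerProductSpace BoundedContinuousFunction

/-! ### Truncation, tightness and limits of moment sequences -/

/-- Truncation of a continuous real function to the interval `[-R, R]`. -/
noncomputable def clampBCF {X : Type*} [TopologicalSpace X] (f : X → ℝ) (hf : Continuous f)
    (R : ℝ) : X →ᵇ ℝ :=
  BoundedContinuousFunction.ofNormedAddCommGroup (fun x => max (-R) (min R (f x)))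
    (by fun_prop) |R| (fun x => by
      rw [Real.norm_eq_abs, abs_le]
      refine ⟨(neg_le_neg (le_abs_self R)).trans (le_max_left _ _), ?_⟩
      exact max_le (neg_le_abs R) ((min_le_left _ _).trans (le_abs_self R)))

lemma clampBCF_apply {X : Type*} [TopologicalSpace X] {f : X → ℝ} (hf : Continuous f) (R : ℝ)
    (x : X) : clampBCF f hf R x = max (-R) (min R (f x)) := rfl

/-- The error is nonzero only where |y| > R, and there it is at most |y| ≤ y²/R. Second moments thus
control truncation uniformly over a family of measures. -/
lemma abs_sub_clamp_le {R : ℝ} (hR : 0 < R) (y : ℝ) :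
    |y - max (-R) (min R y)| ≤ y ^ 2 / R := by
  rw [le_div_iff₀ hR]
  rcases le_total y (-R) with h | h
  · rw [min_eq_right (by linarith), max_eq_left h, abs_of_nonpos (by linarith)]
    nlinarith
  · rcases le_total y R with h' | h'
    · rw [min_eq_right h', max_eq_right h]
      simpa using sq_nonneg y
    · rw [min_eq_left h', max_eq_right (by linarith), abs_of_nonneg (by linarith)]
      nlinarith

/-- Truncating `f` at height `R` changes its integral by at most `∫ f ^ 2 / R`. -/
lemma abs_integral_sub_integral_clampBCF_le {μ : Measure ℝ} [IsProbabilityMeasure μ] {f : ℝ → ℝ}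
    (hf : Continuous f) (hi : Integrable f μ) (hi2 : Integrable (fun x => f x ^ 2) μ) {R : ℝ}
    (hR : 0 < R) :
    |(∫ x, f x ∂μ) - ∫ x, clampBCF f hf R x ∂μ| ≤ (∫ x, f x ^ 2 ∂μ) / R := by
  rw [← integral_sub hi ((clampBCF f hf R).integrable μ), ← integral_div]
  refine (abs_integral_le_integral_abs).trans (integral_mono ?_ (hi2.div_const R) fun x => ?_)
  · exact (hi.sub ((clampBCF f hf R).integrable μ)).abs
  · exact abs_sub_clamp_le hR (f x)

lemma integral_clampBCF_le {μ : Measure ℝ} [IsProbabilityMeasure μ] {f : ℝ → ℝ}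
    (hf : Continuous f) (h0 : ∀ x, 0 ≤ f x) (hi : Integrable f μ) {R : ℝ} (hR : 0 ≤ R) :
    ∫ x, clampBCF f hf R x ∂μ ≤ ∫ x, f x ∂μ :=
  integral_mono ((clampBCF f hf R).integrable μ) hi fun x =>
    max_le ((neg_nonpos.2 hR).trans (h0 x)) (min_le_right _ _)

/-- Fatou's lemma for the truncations of a nonnegative continuous function. -/
lemma integrable_and_integral_le_of_clampBCF_le {μ : Measure ℝ} [IsProbabilityMeasure μ]
    {f : ℝ → ℝ} (hf : Continuous f) (h0 : ∀ x, 0 ≤ f x) {C : ℝ}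
    (h : ∀ n : ℕ, ∫ x, clampBCF f hf n x ∂μ ≤ C) :
    Integrable f μ ∧ ∫ x, f x ∂μ ≤ C := by
  have hC : 0 ≤ C := by
    refine le_trans (integral_nonneg fun x => ?_) (h 0)
    simp [clampBCF_apply]
  have hpos : ∀ (n : ℕ) x, 0 ≤ clampBCF f hf n x := fun n x =>
    (le_min (Nat.cast_nonneg n) (h0 x)).trans (le_max_right _ _)
  have hval : ∀ (n : ℕ) x, clampBCF f hf n x = min (n : ℝ) (f x) := fun n x =>
    max_eq_right ((neg_nonpos.2 (Nat.cast_nonneg n)).trans (le_min (Nat.cast_nonneg n) (h0 x)))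
  have hle : ∫⁻ x, ENNReal.ofReal (f x) ∂μ ≤ ENNReal.ofReal C := by
    refine le_of_tendsto (lintegral_tendsto_of_tendsto_of_monotone
      (f := fun n x => ENNReal.ofReal (clampBCF f hf n x)) (fun n => ?_) (ae_of_all _ ?_)
      (ae_of_all _ ?_)) (Eventually.of_forall fun n => ?_)
    · exact (clampBCF f hf n).continuous.measurable.ennreal_ofReal.aemeasurable
    · intro x m n hmn
      simp only [hval]
      exact ENNReal.ofReal_le_ofReal (min_le_min_right _ (by exact_mod_cast hmn))
    · intro x
      refine tendsto_const_nhds.congr' ?_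
      obtain ⟨N, hN⟩ := exists_nat_ge (f x)
      filter_upwards [eventually_ge_atTop N] with n hn
      rw [hval, min_eq_right (hN.trans (by exact_mod_cast hn))]
    · rw [← ofReal_integral_eq_lintegral_ofReal ((clampBCF f hf n).integrable μ)
        (ae_of_all _ (hpos n))]
      exact ENNReal.ofReal_le_ofReal (h n)
  have hint : Integrable f μ := by
    refine ⟨hf.aestronglyMeasurable, ?_⟩
    rw [hasFiniteIntegral_iff_ofReal (ae_of_all _ h0)]
    exact hle.trans_lt ENNReal.ofReal_lt_top
  refine ⟨hint, ?_⟩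
  rw [← ofReal_integral_eq_lintegral_ofReal hint (ae_of_all _ h0)] at hle
  exact (ENNReal.ofReal_le_ofReal_iff hC).1 hle

/-- Chebyshev bound: uniformly bounded second moments give tightness. -/
lemma isTightMeasureSet_of_second_moment_le {S : Set (Measure ℝ)} {C : ℝ}
    (hS : ∀ μ ∈ S, IsProbabilityMeasure μ ∧ Integrable (fun x : ℝ => x ^ 2) μ ∧
      ∫ x, x ^ 2 ∂μ ≤ C) : IsTightMeasureSet S := by
  refine isTightMeasureSet_of_tendsto_measure_norm_gt ?_
  have hlim : Tendsto (fun r : ℝ => ENNReal.ofReal (C / r ^ 2)) atTop (𝓝 0) := by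
    rw [← ENNReal.ofReal_zero]
    exact ENNReal.tendsto_ofReal (tendsto_const_nhds.div_atTop (tendsto_pow_atTop two_ne_zero))
  refine tendsto_of_tendsto_of_tendsto_of_le_of_le' tendsto_const_nhds hlim
    (Eventually.of_forall fun _ => zero_le) ?_
  filter_upwards [eventually_gt_atTop 0] with r hr
  refine iSup₂_le fun μ hμ => ?_
  obtain ⟨hp, hi, hC⟩ := hS μ hμ
  have hmarkov := mul_meas_ge_le_integral_of_nonneg
    (ae_of_all μ fun x : ℝ => sq_nonneg x) hi (r ^ 2)
  have hsub : μ {x : ℝ | r < ‖x‖} ≤ μ {x : ℝ | r ^ 2 ≤ x ^ 2} := by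
    refine measure_mono fun x (hx : r < |x|) => ?_
    have := pow_le_pow_left₀ hr.le hx.le 2
    rwa [sq_abs] at this
  refine hsub.trans ?_
  rw [← ENNReal.ofReal_toReal (measure_ne_top μ _)]
  refine ENNReal.ofReal_le_ofReal ?_
  rw [le_div_iff₀ (by positivity), mul_comm]
  exact hmarkov.trans hC

/-- If the first `N` moments of the `N`-th member of a sequence of probability measures are given by
a sequence `m`, then `m` is a moment sequence. -/
theorem exists_probabilityMeasure_moments_of_truncated {m : ℕ → ℝ}
    (h : ∀ N : ℕ, ∃ μ : Measure ℝ, IsProbabilityMeasure μ ∧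
      (∀ k : ℕ, Integrable (fun x : ℝ => x ^ k) μ) ∧ ∀ k ≤ N, ∫ x, x ^ k ∂μ = m k) :
    ∃ ν : Measure ℝ, IsProbabilityMeasure ν ∧
      (∀ k : ℕ, Integrable (fun x : ℝ => x ^ k) ν) ∧ ∀ k, ∫ x, x ^ k ∂ν = m k := by
  -- The shift by 2 gives every member of the sequence the second moment `m 2`, hence tightness.
  choose ρ hρp hρi hρm using fun N => h (N + 2)
  let P : ℕ → ProbabilityMeasure ℝ := fun N => ⟨ρ N, hρp N⟩
  have htight : IsTightMeasureSet
      {((μ : ProbabilityMeasure ℝ) : Measure ℝ) | μ ∈ Set.range P} := by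
    refine isTightMeasureSet_of_second_moment_le (C := m 2) ?_
    rintro _ ⟨_, ⟨N, rfl⟩, rfl⟩
    exact ⟨hρp N, hρi N 2, (hρm N 2 (by omega)).le⟩
  have hcomp := isCompact_closure_of_isTightMeasureSet htight
  -- A limit along a non-principal ultrafilter replaces the extraction of a subsequence.
  obtain ⟨ν, -, hν⟩ := hcomp.ultrafilter_le_nhds ((hyperfilter ℕ).map P) (by
    rw [Ultrafilter.coe_map, le_principal_iff]
    exact Filter.mem_map.2 (Filter.univ_mem' fun N => subset_closure ⟨N, rfl⟩))
  have hconv := ProbabilityMeasure.tendsto_iff_forall_integral_tendsto.1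
    (show Tendsto P (hyperfilter ℕ : Filter ℕ) (𝓝 ν) from hν)
  have hlarge : ∀ k : ℕ, ∀ᶠ N in (hyperfilter ℕ : Filter ℕ), k ≤ N + 2 := fun k => by
    refine Filter.le_def.1 (Nat.hyperfilter_le_atTop) _ ?_
    filter_upwards [eventually_ge_atTop k] with N hN
    omega
  have heven : ∀ k : ℕ, Integrable (fun x : ℝ => (x ^ k) ^ 2) (ν : Measure ℝ) ∧
      ∫ x : ℝ, (x ^ k) ^ 2 ∂(ν : Measure ℝ) ≤ m (2 * k) := fun k => by
    have hcont : Continuous fun x : ℝ => (x ^ k) ^ 2 := by fun_prop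
    refine integrable_and_integral_le_of_clampBCF_le hcont (fun x => sq_nonneg _) fun n => ?_
    refine le_of_tendsto (hconv (clampBCF _ hcont n)) ?_
    filter_upwards [hlarge (2 * k)] with N hN
    have := hρp N
    have hi : Integrable (fun x : ℝ => (x ^ k) ^ 2) (ρ N) := by
      simpa only [← pow_mul, mul_comm k 2] using hρi N (2 * k)
    refine (integral_clampBCF_le hcont (fun x => sq_nonneg _) hi (Nat.cast_nonneg n)).trans ?_
    rw [← hρm N (2 * k) hN]
    simp only [← pow_mul, mul_comm k 2, le_refl]
  have hint : ∀ k : ℕ, Integrable (fun x : ℝ => x ^ k) (ν : Measure ℝ) := fun k => by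
    refine Integrable.mono' ((heven k).1.add (integrable_const 1))
      (by fun_prop) (ae_of_all _ fun x => ?_)
    simp only [Pi.add_apply, Real.norm_eq_abs]
    -- The domination used is |y| ≤ y² + 1 with y = x^k.
    nlinarith [sq_abs (x ^ k), sq_nonneg (|x ^ k| - 1), sq_nonneg (|x ^ k|)]
  refine ⟨ν, inferInstance, hint, fun k => ?_⟩
  have hcont : Continuous fun x : ℝ => x ^ k := by fun_prop
  -- Truncation at height n + 1 costs at most m(2k)/(n + 1), both for the limit and for all late
  -- members of the sequence; truncated integrals converge weakly.
  have key : ∀ n : ℕ, |(∫ x : ℝ, x ^ k ∂(ν : Measure ℝ)) - m k| ≤ 2 * m (2 * k) / (n + 1) := by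
    intro n
    have hR : (0 : ℝ) < n + 1 := by positivity
    have h1 := abs_integral_sub_integral_clampBCF_le hcont (hint k) (heven k).1 hR
    have h2 : |m k - ∫ x, clampBCF _ hcont (n + 1) x ∂(ν : Measure ℝ)| ≤ m (2 * k) / (n + 1) := by
      refine le_of_tendsto ((tendsto_const_nhds.sub (hconv (clampBCF _ hcont (n + 1)))).abs) ?_
      filter_upwards [hlarge k, hlarge (2 * k)] with N hN hN'
      have := hρp N
      have hi : Integrable (fun x : ℝ => (x ^ k) ^ 2) (ρ N) := by
        simpa only [← pow_mul, mul_comm k 2] using hρi N (2 * k)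
      have := abs_integral_sub_integral_clampBCF_le hcont (hρi N k) hi hR
      rw [hρm N k hN] at this
      refine this.trans_eq ?_
      rw [← hρm N (2 * k) hN']
      simp only [← pow_mul, mul_comm k 2]
    have h3 := (div_le_div_iff_of_pos_right hR).2 (heven k).2
    rw [abs_sub_comm] at h2
    calc _ ≤ _ := abs_sub_le _ _ _
      _ ≤ _ := add_le_add (h1.trans h3) h2
      _ = _ := by ring
  have hlim : Tendsto (fun n : ℕ => 2 * m (2 * k) / ((n : ℝ) + 1)) atTop (𝓝 0) :=
    tendsto_const_nhds.div_atTop (tendsto_atTop_add_const_right _ _ tendsto_natCast_atTop_atTop)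
  have := ge_of_tendsto' hlim key
  exact sub_eq_zero.1 (abs_eq_zero.1 (le_antisymm this (abs_nonneg _)))

/-! ### Spectral measures and the Hamburger moment problem -/

/-- Spectral measure of a symmetric operator on a finite-dimensional space. -/
theorem LinearMap.IsSymmetric.exists_spectralMeasure {E : Type*} [NormedAddCommGroup E]
    [InnerProductSpace ℝ E] [FiniteDimensional ℝ E] {T : E →ₗ[ℝ] E} (hT : T.IsSymmetric) (v : E)
    (hv : ‖v‖ = 1) :
    ∃ μ : Measure ℝ, IsProbabilityMeasure μ ∧ (∀ k : ℕ, Integrable (fun x : ℝ => x ^ k) μ) ∧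
      ∀ k : ℕ, ∫ x, x ^ k ∂μ = ⟪(T ^ k) v, v⟫_ℝ := by
  let b := hT.eigenvectorBasis rfl
  let lam := hT.eigenvalues rfl
  have hpow : ∀ (k : ℕ) i, ⟪(T ^ k) v, b i⟫_ℝ = lam i ^ k * ⟪v, b i⟫_ℝ := by
    intro k i
    induction k with
    | zero => simp
    | succ k ih =>
      rw [pow_succ', Module.End.mul_apply, hT, hT.apply_eigenvectorBasis rfl i, inner_smul_right]
      change _ * ⟪(T ^ k) v, b i⟫_ℝ = _
      rw [ih]
      simp only [lam, RCLike.ofReal_real_eq_id, id_eq]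
      ring
  have hmom : ∀ k : ℕ, ⟪(T ^ k) v, v⟫_ℝ = ∑ i, ⟪v, b i⟫_ℝ ^ 2 * lam i ^ k := by
    intro k
    rw [← b.sum_inner_mul_inner]
    refine Finset.sum_congr rfl fun i _ => ?_
    rw [hpow, real_inner_comm v (b i)]
    ring
  let μ : Measure ℝ := ∑ i, ENNReal.ofReal (⟪v, b i⟫_ℝ ^ 2) • Measure.dirac (lam i)
  have hint : ∀ f : ℝ → ℝ, ∀ i,
      Integrable f (ENNReal.ofReal (⟪v, b i⟫_ℝ ^ 2) • Measure.dirac (lam i)) := fun f i =>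
    (integrable_dirac (by simp)).smul_measure ENNReal.ofReal_ne_top
  refine ⟨μ, ⟨?_⟩, fun k => ?_, fun k => ?_⟩
  · have h0 := hmom 0
    simp only [pow_zero, Module.End.one_apply, mul_one, real_inner_self_eq_norm_sq, hv,
      one_pow] at h0
    simp only [μ, Measure.coe_finsetSum, Finset.sum_apply, Measure.smul_apply, measure_univ,
      smul_eq_mul, mul_one]
    rw [← ENNReal.ofReal_sum_of_nonneg fun i _ => sq_nonneg _, ← h0, ENNReal.ofReal_one]
  · exact integrable_finsetSum_measure.2 fun i _ => hint _ i
  · rw [hmom, integral_finsetSum_measure fun i _ => hint _ i]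
    refine Finset.sum_congr rfl fun i _ => ?_
    rw [integral_smul_measure, integral_dirac, ENNReal.toReal_ofReal (sq_nonneg _), smul_eq_mul]

/-- **Hamburger moment problem** in operator form: the moments of a symmetric operator with respect
to a unit vector are the moments of a probability measure. -/
theorem LinearMap.IsSymmetric.exists_measure_moments {V : Type*} [NormedAddCommGroup V]
    [InnerProductSpace ℝ V] {J : V →ₗ[ℝ] V} (hJ : J.IsSymmetric) (e : V) (he : ‖e‖ = 1) :
    ∃ ν : Measure ℝ, IsProbabilityMeasure ν ∧ (∀ k : ℕ, Integrable (fun x : ℝ => x ^ k) ν) ∧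
      ∀ k : ℕ, ∫ x, x ^ k ∂ν = ⟪(J ^ k) e, e⟫_ℝ := by
  refine exists_probabilityMeasure_moments_of_truncated fun N => ?_
  -- The vectors J^k e with k ≤ N lie in this Krylov space, so the projection in the compression `T`
  -- does not affect the first N powers on `e`.
  let K : Submodule ℝ V := Submodule.span ℝ ((fun k => (J ^ k) e) '' (Finset.range (N + 1)))
  have : FiniteDimensional ℝ K :=
    FiniteDimensional.span_of_finite ℝ ((Finset.finite_toSet _).image _)
  have hmem : ∀ k ≤ N, (J ^ k) e ∈ K := fun k hk =>
    Submodule.subset_span ⟨k, by simpa using Nat.lt_succ_of_le hk, rfl⟩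
  let T : K →ₗ[ℝ] K := K.orthogonalProjectionOnto.toLinearMap ∘ₗ J ∘ₗ K.subtype
  have hT : T.IsSymmetric := fun x y => by
    change ⟪K.orthogonalProjectionOnto (J x), y⟫_ℝ = ⟪x, K.orthogonalProjectionOnto (J y)⟫_ℝ
    rw [Submodule.inner_orthogonalProjectionOnto_eq_of_mem_right,
      Submodule.inner_orthogonalProjectionOnto_eq_of_mem_left]
    exact hJ x y
  let e' : K := ⟨e, by simpa using hmem 0 (Nat.zero_le _)⟩
  have hpow : ∀ k ≤ N, (((T ^ k) e' : K) : V) = (J ^ k) e := by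
    intro k
    induction k with
    | zero => intro _; rfl
    | succ k ih =>
      intro hk
      rw [pow_succ', pow_succ', Module.End.mul_apply, Module.End.mul_apply]
      change ((K.orthogonalProjectionOnto (J ((T ^ k) e' : K)) : K) : V) = _
      rw [ih (by omega)]
      have hm := hmem (k + 1) hk
      rw [pow_succ', Module.End.mul_apply] at hm
      exact Submodule.starProjection_eq_self_iff.2 hm
  obtain ⟨μ, hp, hi, hm⟩ := hT.exists_spectralMeasure e' he
  refine ⟨μ, hp, hi, fun k hk => ?_⟩
  rw [hm, Submodule.coe_inner, hpow k hk]

/-! ### Growth of iterates, growth of moments and compact support -/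

open Polynomial

/-- If the iterates of a symmetric operator at `v` grow at most like `M ^ n`, then the operator
does not stretch `v` by more than `M`. -/
theorem LinearMap.IsSymmetric.norm_apply_le_of_pow_growth {V : Type*} [NormedAddCommGroup V]
    [InnerProductSpace ℝ V] {J : V →ₗ[ℝ] V} (hJ : J.IsSymmetric) (v : V) {C M : ℝ} (hM : 0 < M)
    (h : ∀ n : ℕ, ‖(J ^ n) v‖ ^ 2 ≤ C * M ^ (2 * n)) : ‖J v‖ ≤ M * ‖v‖ := by
  by_cases hv : v = 0
  · simp [hv]
  have hv0 : 0 < ‖v‖ := norm_pos_iff.2 hv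
  -- Log-convexity of n ↦ ‖Jⁿv‖, by symmetry and Cauchy–Schwarz. Successive ratios therefore never
  -- drop below the first one, ‖Jv‖/‖v‖, which the growth hypothesis then bounds by M.
  have hlog : ∀ n : ℕ, ‖(J ^ (n + 1)) v‖ ^ 2 ≤ ‖(J ^ n) v‖ * ‖(J ^ (n + 2)) v‖ := by
    intro n
    rw [← real_inner_self_eq_norm_sq, pow_succ' J (n + 1), pow_succ' J n, Module.End.mul_apply,
      Module.End.mul_apply, hJ]
    exact real_inner_le_norm _ _
  have hratio : ∀ n : ℕ, ‖J v‖ * ‖(J ^ n) v‖ ≤ ‖v‖ * ‖(J ^ (n + 1)) v‖ := by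
    intro n
    induction n with
    | zero => simp [mul_comm]
    | succ n ih =>
      rcases (norm_nonneg ((J ^ (n + 1)) v)).eq_or_lt with h0 | h0
      · rw [← h0]; simp; positivity
      have hn : 0 < ‖(J ^ n) v‖ := by
        rcases (norm_nonneg ((J ^ n) v)).eq_or_lt with h1 | h1
        · have := hlog n
          rw [← h1, zero_mul] at this
          nlinarith
        · exact h1
      have h2 := mul_le_mul_of_nonneg_left (hlog n) hv0.le
      have h3 := mul_le_mul_of_nonneg_right ih h0.le
      refine le_of_mul_le_mul_left ?_ hn
      calc _ = ‖J v‖ * ‖(J ^ n) v‖ * ‖(J ^ (n + 1)) v‖ := by ring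
        _ ≤ _ := h3
        _ = ‖v‖ * ‖(J ^ (n + 1)) v‖ ^ 2 := by ring
        _ ≤ _ := h2
        _ = _ := by ring
  have hgrow : ∀ n : ℕ, (‖J v‖ / ‖v‖) ^ n * ‖v‖ ≤ ‖(J ^ n) v‖ := by
    intro n
    induction n with
    | zero => simp
    | succ n ih =>
      have h1 : ‖J v‖ / ‖v‖ * ‖(J ^ n) v‖ ≤ ‖(J ^ (n + 1)) v‖ := by
        rw [div_mul_eq_mul_div, div_le_iff₀ hv0, mul_comm _ ‖v‖]
        exact hratio n
      calc _ = ‖J v‖ / ‖v‖ * ((‖J v‖ / ‖v‖) ^ n * ‖v‖) := by ring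
        _ ≤ _ := mul_le_mul_of_nonneg_left ih (by positivity)
        _ ≤ _ := h1
  rw [← div_le_iff₀ hv0]
  by_contra! hlt
  set t := ‖J v‖ / ‖v‖ with ht
  have hr : 1 < (t / M) ^ 2 := one_lt_pow₀ ((one_lt_div hM).2 hlt) two_ne_zero
  obtain ⟨n, hn⟩ := pow_unbounded_of_one_lt (C / ‖v‖ ^ 2) hr
  have h1 : (t ^ n * ‖v‖) ^ 2 ≤ C * M ^ (2 * n) :=
    (pow_le_pow_left₀ (by positivity) (hgrow n) 2).trans (h n)
  rw [div_lt_iff₀ (by positivity), ← pow_mul, div_pow, div_mul_eq_mul_div,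
    lt_div_iff₀ (by positivity)] at hn
  rw [mul_pow, ← pow_mul, mul_comm n 2] at h1
  linarith

/-- The moments of a compactly supported probability measure grow at most geometrically. -/
lemma exists_abs_moment_le_of_isCompact_support {ν : Measure ℝ} [IsProbabilityMeasure ν]
    (h : IsCompact ν.support) : ∃ M : ℝ, 0 < M ∧ ∀ n : ℕ, |∫ x, x ^ n ∂ν| ≤ M ^ n := by
  obtain ⟨M, hM, hsub⟩ := h.isBounded.subset_closedBall_lt 0 0
  refine ⟨M, hM, fun n => ?_⟩
  have := norm_integral_le_of_norm_le_const (μ := ν) (f := fun x : ℝ => x ^ n) (C := M ^ n) (by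
    filter_upwards [Measure.support_mem_ae] with x hx
    rw [norm_pow]
    exact pow_le_pow_left₀ (norm_nonneg _) (by simpa using hsub hx) n)
  simpa using this

/-- Geometric growth of the even moments about some point forces compact support. -/
lemma isCompact_support_of_even_moment_le {μ : Measure ℝ} [IsProbabilityMeasure μ] {c M : ℝ}
    (hM : 0 < M) (hi : ∀ n : ℕ, Integrable (fun x : ℝ => (x + c) ^ (2 * n)) μ)
    (h : ∀ n : ℕ, ∫ x, (x + c) ^ (2 * n) ∂μ ≤ M ^ (2 * n)) : IsCompact μ.support := by
  -- Markov's inequality for the power 2n at the threshold 2M gives mass at most (M/2M)^(2n) = 4⁻ⁿ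
  -- for every n.
  have hnull : μ {x : ℝ | 2 * M ≤ |x + c|} = 0 := by
    have hbound : ∀ n : ℕ, μ.real {x : ℝ | 2 * M ≤ |x + c|} ≤ (1 / 4) ^ n := by
      intro n
      have hmarkov := mul_meas_ge_le_integral_of_nonneg
        (ae_of_all μ fun x : ℝ => (even_two_mul n).pow_nonneg (x + c)) (hi n) ((2 * M) ^ (2 * n))
      have hsub : μ.real {x : ℝ | 2 * M ≤ |x + c|} ≤
          μ.real {x : ℝ | (2 * M) ^ (2 * n) ≤ (x + c) ^ (2 * n)} := by
        refine measureReal_mono fun x (hx : 2 * M ≤ |x + c|) => ?_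
        have := pow_le_pow_left₀ (by positivity) hx (2 * n)
        rwa [(even_two_mul n).pow_abs] at this
      have h1 : (2 * M) ^ (2 * n) * μ.real {x : ℝ | 2 * M ≤ |x + c|} ≤ M ^ (2 * n) :=
        (mul_le_mul_of_nonneg_left hsub (by positivity)).trans (hmarkov.trans (h n))
      have h2 : (2 * M) ^ (2 * n) = 4 ^ n * M ^ (2 * n) := by
        rw [mul_pow, pow_mul 2 2 n]; norm_num
      rw [h2, mul_right_comm] at h1
      have h3 := le_of_mul_le_mul_right (a := M ^ (2 * n)) (c := 1) (by simpa using h1)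
        (by positivity)
      rw [one_div, inv_pow, ← one_div, le_div_iff₀ (by positivity), mul_comm]
      exact h3
    have hle := ge_of_tendsto' (tendsto_pow_atTop_nhds_zero_of_lt_one (by norm_num : (0:ℝ) ≤ 1 / 4)
      (by norm_num)) hbound
    exact (measureReal_eq_zero_iff).1 (le_antisymm hle measureReal_nonneg)
  refine (isCompact_closedBall (-c) (2 * M)).of_isClosed_subset Measure.isClosed_support
    (Measure.support_subset_of_isClosed Metric.isClosed_closedBall ?_)
  rw [mem_ae_iff]
  refine measure_mono_null (fun x hx => ?_) hnull
  simp only [Set.mem_compl_iff, Metric.mem_closedBall, Real.dist_eq, sub_neg_eq_add, not_le] at hx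
  exact hx.le

/-! ### Orthonormal polynomials -/

lemma integrable_eval_of_integrable_pow {μ : Measure ℝ}
    (hi : ∀ n : ℕ, Integrable (fun x : ℝ => x ^ n) μ) (p : ℝ[X]) :
    Integrable (fun x => p.eval x) μ := by
  simp only [eval_eq_sum_range]
  exact integrable_finsetSum _ fun i _ => (hi i).const_mul _

/-- A polynomial which vanishes in mean square for a measure without compact support is zero. -/
lemma Polynomial.eq_zero_of_integral_sq_eq_zero {μ : Measure ℝ} [IsProbabilityMeasure μ]
    (hi : ∀ n : ℕ, Integrable (fun x : ℝ => x ^ n) μ) (hnc : ¬ IsCompact μ.support) {p : ℝ[X]}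
    (hp : ∫ x, p.eval x * p.eval x ∂μ = 0) : p = 0 := by
  by_contra hp0
  -- The measure would be carried by the finite root set of `p`, which is compact.
  refine hnc ((p.rootSet_finite ℝ).isCompact.of_isClosed_subset Measure.isClosed_support
    (Measure.support_subset_of_isClosed (p.rootSet_finite ℝ).isClosed ?_))
  have hint : Integrable (fun x => p.eval x * p.eval x) μ := by
    simpa only [eval_mul] using integrable_eval_of_integrable_pow hi (p * p)
  have := (integral_eq_zero_iff_of_nonneg (fun x => mul_self_nonneg _) hint).1 hp
  filter_upwards [this] with x hx
  rw [mem_rootSet]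
  exact ⟨hp0, by simpa using hx⟩

/-- Orthonormal polynomials of a probability measure on the line without compact support. -/
theorem exists_orthonormal_polynomial_basis {μ : Measure ℝ} [IsProbabilityMeasure μ]
    (hi : ∀ n : ℕ, Integrable (fun x : ℝ => x ^ n) μ) (hnc : ¬ IsCompact μ.support) :
    ∃ b : Module.Basis ℕ ℝ ℝ[X], b 0 = 1 ∧
      ∀ m n, ∫ x, (b m).eval x * (b n).eval x ∂μ = if m = n then 1 else 0 := by
  have hint : ∀ p q : ℝ[X], Integrable (fun x => p.eval x * q.eval x) μ := fun p q => by
    simpa only [eval_mul] using integrable_eval_of_integrable_pow hi (p * q)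
  let core : InnerProductSpace.Core ℝ ℝ[X] :=
    { inner := fun p q => ∫ x, p.eval x * q.eval x ∂μ
      conj_inner_symm := fun p q => by
        simp only [conj_trivial, mul_comm]
      re_inner_nonneg := fun p => integral_nonneg fun x => mul_self_nonneg _
      add_left := fun p q r => by
        simp only [eval_add, add_mul]
        exact integral_add (hint p r) (hint q r)
      smul_left := fun p q c => by
        simp only [eval_smul, smul_eq_mul, mul_assoc, conj_trivial]
        exact integral_const_mul _ _
      definite := fun p hp => p.eq_zero_of_integral_sq_eq_zero hi hnc hp }
  let : NormedAddCommGroup ℝ[X] := core.toNormedAddCommGroup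
  let : InnerProductSpace ℝ ℝ[X] := InnerProductSpace.ofCore core.toCore
  have hinner : ∀ p q : ℝ[X], ⟪p, q⟫_ℝ = ∫ x, p.eval x * q.eval x ∂μ := fun _ _ => rfl
  let f := (Polynomial.basisMonomials ℝ)
  let g := InnerProductSpace.gramSchmidtNormed ℝ f
  have hlin : LinearIndependent ℝ g :=
    InnerProductSpace.gramSchmidtNormed_linearIndependent f.linearIndependent
  have hspan : ⊤ ≤ Submodule.span ℝ (Set.range g) := by
    rw [InnerProductSpace.span_gramSchmidtNormed_range, InnerProductSpace.span_gramSchmidt,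
      f.span_eq]
  have hortho := InnerProductSpace.gramSchmidtNormed_orthonormal (𝕜 := ℝ) f.linearIndependent
  refine ⟨Module.Basis.mk hlin hspan, ?_, fun m n => ?_⟩
  · have h0 : f 0 = 1 := by simp [f]
    have hn : ‖(1 : ℝ[X])‖ = 1 := by
      have h1 : ‖(1 : ℝ[X])‖ ^ 2 = 1 := by
        rw [← real_inner_self_eq_norm_sq, hinner]
        simp
      exact (pow_eq_one_iff_of_nonneg (norm_nonneg _) two_ne_zero).1 h1
    rw [Module.Basis.mk_apply]
    have hbot := InnerProductSpace.gramSchmidt_bot (𝕜 := ℝ) (f : ℕ → ℝ[X])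
    rw [Nat.bot_eq_zero] at hbot
    simp [g, InnerProductSpace.gramSchmidtNormed, hbot, h0, hn]
  · rw [Module.Basis.mk_apply, Module.Basis.mk_apply, ← hinner]
    exact orthonormal_iff_ite.1 hortho m n

/-! ### Freeness and traciality -/

/-- Alternating lists of centred elements of the subalgebras `S i`. -/
structure IsAlternatingCentered {A : Type*} [Ring A] [Algebra ℂ A] (φ : A →ₗ[ℂ] ℂ) {ι : Type*}
    (S : ι → Subalgebra ℂ A) (l : List (ι × A)) : Prop where
  mem : ∀ s ∈ l, s.2 ∈ S s.1
  centered : ∀ s ∈ l, φ s.2 = 0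
  chain : l.IsChain fun s t => s.1 ≠ t.1

section Freeness

variable {A : Type*} [Ring A] [Algebra ℂ A] {φ : A →ₗ[ℂ] ℂ} {ι : Type*} {S : ι → Subalgebra ℂ A}

lemma FreelyIndependentSubalgebras.apply_prod_eq_zero (hfree : FreelyIndependentSubalgebras φ S)
    {l : List (ι × A)} (hl : IsAlternatingCentered φ S l) (hne : l ≠ []) :
    φ (l.map Prod.snd).prod = 0 := by
  rcases Nat.lt_or_ge l.length 2 with h2 | h2
  · match l, hne, h2 with
    | [s], _, _ => simpa using hl.centered s (by simp)
  · have h := hfree l.length h2 (fun k => (l.get k).1) (fun k => (l.get k).2)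
      (fun k => hl.mem _ (List.get_mem _ _)) (fun k => hl.centered _ (List.get_mem _ _))
      (fun k m hkm => by
        have := List.isChain_iff_getElem.1 hl.chain k (by omega)
        simpa [hkm] using this)
    have hof : List.ofFn (fun k : Fin l.length => (l.get k).2) = l.map Prod.snd := by
      apply List.ext_getElem <;> simp
    rwa [hof] at h

lemma IsAlternatingCentered.tail {s : ι × A} {l : List (ι × A)}
    (h : IsAlternatingCentered φ S (s :: l)) : IsAlternatingCentered φ S l :=
  ⟨fun t ht => h.mem t (List.mem_cons_of_mem _ ht),
    fun t ht => h.centered t (List.mem_cons_of_mem _ ht), h.chain.tail⟩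

lemma IsAlternatingCentered.init {s : ι × A} {l : List (ι × A)}
    (h : IsAlternatingCentered φ S (l ++ [s])) : IsAlternatingCentered φ S l :=
  ⟨fun t ht => h.mem t (List.mem_append_left _ ht),
    fun t ht => h.centered t (List.mem_append_left _ ht), h.chain.left_of_append⟩

/-- The first factor of an alternating product of length at least two need not be centred. -/
lemma FreelyIndependentSubalgebras.apply_mul_prod_eq_zero
    (hfree : FreelyIndependentSubalgebras φ S) (hφ : φ 1 = 1) {l : List (ι × A)}
    (hl : IsAlternatingCentered φ S l) (hne : l ≠ []) {i : ι} {z : A} (hz : z ∈ S i)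
    (hchain : ((i, z) :: l).IsChain fun s t => s.1 ≠ t.1) :
    φ (z * (l.map Prod.snd).prod) = 0 := by
  -- Centring `z` changes the product by a multiple of the shorter alternating product, on which `φ`
  -- already vanishes.
  have h0 : IsAlternatingCentered φ S ((i, z - algebraMap ℂ A (φ z)) :: l) := by
    refine ⟨?_, ?_, ?_⟩
    · simp only [List.mem_cons, forall_eq_or_imp]
      exact ⟨(S i).sub_mem hz ((S i).algebraMap_mem _), hl.mem⟩
    · simp only [List.mem_cons, forall_eq_or_imp]
      refine ⟨?_, hl.centered⟩
      rw [map_sub, Algebra.algebraMap_eq_smul_one, map_smul, hφ]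
      simp
    · rw [List.isChain_cons] at hchain ⊢
      exact hchain
  have h1 := hfree.apply_prod_eq_zero h0 (by simp)
  rw [List.map_cons, List.prod_cons, sub_mul, map_sub, ← Algebra.smul_def, map_smul,
    hfree.apply_prod_eq_zero hl hne, smul_zero, sub_zero] at h1
  exact h1

/-- The last factor of an alternating product of length at least two need not be centred. -/
lemma FreelyIndependentSubalgebras.apply_prod_mul_eq_zero
    (hfree : FreelyIndependentSubalgebras φ S) (hφ : φ 1 = 1) {l : List (ι × A)}
    (hl : IsAlternatingCentered φ S l) (hne : l ≠ []) {i : ι} {z : A} (hz : z ∈ S i)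
    (hchain : (l ++ [(i, z)]).IsChain fun s t => s.1 ≠ t.1) :
    φ ((l.map Prod.snd).prod * z) = 0 := by
  have h0 : IsAlternatingCentered φ S (l ++ [(i, z - algebraMap ℂ A (φ z))]) := by
    refine ⟨?_, ?_, ?_⟩
    · simp only [List.mem_append, List.mem_singleton]
      rintro s (hs | rfl)
      · exact hl.mem s hs
      · exact (S i).sub_mem hz ((S i).algebraMap_mem _)
    · simp only [List.mem_append, List.mem_singleton]
      rintro s (hs | rfl)
      · exact hl.centered s hs
      · rw [map_sub, Algebra.algebraMap_eq_smul_one, map_smul, hφ]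
        simp
    · rw [List.isChain_append] at hchain ⊢
      refine ⟨hchain.1, by simp, fun x hx y hy => ?_⟩
      simp only [List.head?_cons, Option.mem_def, Option.some.injEq] at hy
      subst hy
      exact hchain.2.2 x hx (i, z) (by simp)
  have h1 := hfree.apply_prod_eq_zero h0 (by simp)
  rw [List.map_append, List.prod_append, List.map_cons, List.map_nil, List.prod_singleton, mul_sub,
    map_sub, ← Algebra.commutes, ← Algebra.smul_def, map_smul, hfree.apply_prod_eq_zero hl hne,
    smul_zero, sub_zero] at h1
  exact h1

/-- A free product of commutative algebras is tracial. -/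
theorem FreelyIndependentSubalgebras.apply_mul_comm (hfree : FreelyIndependentSubalgebras φ S)
    (hφ : φ 1 = 1) (hcomm : ∀ i, ∀ x ∈ S i, ∀ y ∈ S i, x * y = y * x) {l : List (ι × A)}
    (hl : IsAlternatingCentered φ S l) {i : ι} {y : A} (hy : y ∈ S i) :
    φ (y * (l.map Prod.snd).prod) = φ ((l.map Prod.snd).prod * y) := by
  rcases eq_or_ne l [] with rfl | hne
  · simp
  by_cases hsingle : ∃ s, l = [s] ∧ s.1 = i
  · obtain ⟨s, rfl, rfl⟩ := hsingle
    simp [hcomm _ _ (hl.mem s (by simp)) _ hy]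
  -- Outside the one-letter case both sides vanish. If `y` meets an end letter of its own index, the
  -- two merge into one factor, perhaps not centred, and at least one centred letter remains.
  have hleft : φ (y * (l.map Prod.snd).prod) = 0 := by
    obtain ⟨⟨j, x⟩, l', rfl⟩ := List.exists_cons_of_ne_nil hne
    by_cases hj : j = i
    · subst hj
      have hne' : l' ≠ [] := fun h => hsingle ⟨(j, x), by rw [h], rfl⟩
      rw [List.map_cons, List.prod_cons, ← mul_assoc]
      refine hfree.apply_mul_prod_eq_zero hφ hl.tail hne'
        ((S j).mul_mem hy (hl.mem (j, x) (by simp))) ?_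
      have := hl.chain
      rw [List.isChain_cons] at this ⊢
      exact this
    · refine hfree.apply_mul_prod_eq_zero hφ hl hne hy ?_
      rw [List.isChain_cons]
      refine ⟨fun t ht => ?_, hl.chain⟩
      simp only [List.head?_cons, Option.mem_def, Option.some.injEq] at ht
      subst ht
      exact Ne.symm hj
  have hright : φ ((l.map Prod.snd).prod * y) = 0 := by
    obtain ⟨l', ⟨j, x⟩, rfl⟩ := List.eq_nil_or_concat' l |>.resolve_left hne
    by_cases hj : j = i
    · subst hj
      have hne' : l' ≠ [] := fun h => hsingle ⟨(j, x), by rw [h]; rfl, rfl⟩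
      rw [List.map_append, List.prod_append, List.map_cons, List.map_nil, List.prod_singleton,
        mul_assoc]
      refine hfree.apply_prod_mul_eq_zero hφ hl.init hne'
        ((S j).mul_mem (hl.mem (j, x) (by simp)) hy) ?_
      have := hl.chain
      rw [List.isChain_append] at this ⊢
      refine ⟨this.1, by simp, fun s hs t ht => ?_⟩
      simp only [List.head?_cons, Option.mem_def, Option.some.injEq] at ht
      subst ht
      exact this.2.2 s hs (j, x) (by simp)
    · refine hfree.apply_prod_mul_eq_zero hφ hl hne hy ?_
      rw [List.isChain_append]
      refine ⟨hl.chain, by simp, fun s hs t ht => ?_⟩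
      simp only [List.head?_cons, Option.mem_def, Option.some.injEq] at ht
      subst ht
      simp only [List.getLast?_append, List.getLast?_singleton, Option.some_or, Option.mem_def,
        Option.some.injEq] at hs
      subst hs
      exact hj
  rw [hleft, hright]

end Freeness

lemma IsSpectralDistribution.apply_aeval {A : Type*} [Ring A] [Algebra ℂ A] {φ : A →ₗ[ℂ] ℂ} {a : A}
    {μ : Measure ℝ} (h : IsSpectralDistribution φ a μ) (q : ℝ[X]) :
    φ (aeval a q) = ((∫ x, q.eval x ∂μ : ℝ) : ℂ) := by
  have hint := integrable_eval_of_integrable_pow h.integrable_pow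
  induction q using Polynomial.induction_on' with
  | add p q hp hq =>
    simp only [map_add, hp, hq, eval_add]
    rw [integral_add (hint p) (hint q), Complex.ofReal_add]
  | monomial n c =>
    have hc : aeval a (monomial n c) = (c : ℂ) • a ^ n := by
      rw [aeval_monomial, ← Algebra.smul_def, Complex.coe_smul]
    rw [hc, map_smul, h.moment_eq]
    simp only [eval_monomial, integral_const_mul, smul_eq_mul, Complex.ofReal_mul]

lemma aeval_real_mem_adjoin {A : Type*} [Ring A] [Algebra ℂ A] (a : A) (q : ℝ[X]) :
    aeval a q ∈ Algebra.adjoin ℂ {a} := by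
  rw [← aeval_map_algebraMap ℂ]
  exact aeval_mem_adjoin_singleton ℂ a

lemma mul_comm_of_mem_adjoin_singleton {A : Type*} [Ring A] [Algebra ℂ A] {a x y : A}
    (hx : x ∈ Algebra.adjoin ℂ {a}) (hy : y ∈ Algebra.adjoin ℂ {a}) : x * y = y * x := by
  rw [Algebra.adjoin_singleton_eq_range_aeval] at hx hy
  obtain ⟨p, rfl⟩ := hx
  obtain ⟨q, rfl⟩ := hy
  simp only [RingHom.coe_coe, AlgHom.toRingHom_eq_coe, ← map_mul, mul_comm p q]

/-! ### The free product space on reduced words -/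

/-- The space of finitely supported functions with its standard inner product. -/
@[reducible]
noncomputable def Finsupp.innerProductCore (α : Type*) : InnerProductSpace.Core ℝ (α →₀ ℝ) where
  inner u v := u.sum fun w c => c * v w
  conj_inner_symm u v := by
    classical
    simp only [conj_trivial]
    rw [Finsupp.sum_of_support_subset u (Finset.subset_union_left (s₂ := v.support)) _ (by simp),
      Finsupp.sum_of_support_subset v (Finset.subset_union_right (s₁ := u.support)) _ (by simp)]
    simp only [mul_comm]
  re_inner_nonneg u := Finset.sum_nonneg fun w _ => mul_self_nonneg _
  add_left u v w := Finsupp.sum_add_index' (by simp) (by intros; ring)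
  smul_left u v r := by
    rw [Finsupp.sum_smul_index' (by simp), Finsupp.sum, Finsupp.sum, Finset.mul_sum]
    simp [mul_assoc]
  definite u hu := by
    ext w
    by_contra hw
    have := (Finset.sum_eq_zero_iff_of_nonneg fun w _ => mul_self_nonneg _).1 hu w
      (Finsupp.mem_support_iff.2 hw)
    exact hw (mul_self_eq_zero.1 this)

/-- Reduced words in letters `(i, n)` with `n ≥ 1`; neighbouring letters have different `i`. -/
abbrev ReducedWord (ι : Type*) := Monoid.CoprodI.Word fun _ : ι => Multiplicative ℕ

namespace ReducedWord

open Monoid.CoprodI.Word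

variable {ι : Type*}

/-- The product of the values `x i n` of the letters of a word. -/
def eval {A : Type*} [Ring A] (x : ι → ℕ → A) (w : ReducedWord ι) : A :=
  (w.toList.map fun s => x s.1 s.2.toAdd).prod

/-- The letters of a word, as an alternating list of elements of the algebra. -/
def letters {A : Type*} (x : ι → ℕ → A) (w : ReducedWord ι) : List (ι × A) :=
  w.toList.map fun s => (s.1, x s.1 s.2.toAdd)

lemma prod_letters {A : Type*} [Ring A] (x : ι → ℕ → A) (w : ReducedWord ι) :
    ((letters x w).map Prod.snd).prod = eval x w := by
  simp [letters, eval, Function.comp_def]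

lemma eval_rcons {A : Type*} [Ring A] {x : ι → ℕ → A} (hx : ∀ i, x i 0 = 1) (i : ι)
    (p : Pair (fun _ : ι => Multiplicative ℕ) i) :
    eval x (rcons p) = x i p.head.toAdd * eval x p.tail := by
  rw [rcons]
  split_ifs with h
  · rw [h, toAdd_one, hx, one_mul]
  · simp [eval, cons]

variable [DecidableEq ι]

/-- Replace the exponent of the leading `i`-block of a word by `n`. -/
def setHead (i : ι) (w : ReducedWord ι) (n : ℕ) : ReducedWord ι :=
  (equivPair i).symm { equivPair i w with head := Multiplicative.ofAdd n }

/-- The exponent of the leading `i`-block of a word. -/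
def headExp (i : ι) (w : ReducedWord ι) : ℕ := (equivPair i w).head.toAdd

lemma equivPair_setHead (i : ι) (w : ReducedWord ι) (n : ℕ) :
    equivPair i (setHead i w n) = { equivPair i w with head := Multiplicative.ofAdd n } :=
  Equiv.apply_symm_apply _ _

lemma setHead_injective (i : ι) (w : ReducedWord ι) : Function.Injective (setHead i w) := by
  intro m n h
  have := congrArg (equivPair i) h
  rw [equivPair_setHead, equivPair_setHead] at this
  exact congrArg (fun p => p.head.toAdd) this

lemma setHead_headExp (i : ι) {w w' : ReducedWord ι}
    (h : (equivPair i w).tail = (equivPair i w').tail) : setHead i w (headExp i w') = w' := by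
  rw [setHead, Equiv.symm_apply_eq]
  ext1
  · rfl
  · exact h

lemma eval_setHead {A : Type*} [Ring A] {x : ι → ℕ → A} (hx : ∀ i, x i 0 = 1) (i : ι) (w : ReducedWord ι) (n : ℕ) :
    eval x (setHead i w n) = x i n * eval x (equivPair i w).tail :=
  eval_rcons hx i _

lemma eval_eq {A : Type*} [Ring A] {x : ι → ℕ → A} (hx : ∀ i, x i 0 = 1) (i : ι) (w : ReducedWord ι) :
    eval x w = x i (headExp i w) * eval x (equivPair i w).tail := by
  conv_lhs => rw [← setHead_headExp i (rfl : (equivPair i w).tail = _), eval_setHead hx]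

variable {A : Type*} [Ring A] [Algebra ℂ A]

/-- The linear extension of `ReducedWord.eval`. -/
noncomputable def evalLin (x : ι → ℕ → A) : (ReducedWord ι →₀ ℝ) →ₗ[ℝ] A :=
  Finsupp.linearCombination ℝ (eval x)

/-- Left multiplication by `q` in the `i`-th variable, on the space with basis the reduced words,
where the letter `(i, n)` stands for the polynomial `b i n`. -/
noncomputable def leftMul (b : ι → Module.Basis ℕ ℝ ℝ[X]) (i : ι) (q : ℝ[X]) :
    (ReducedWord ι →₀ ℝ) →ₗ[ℝ] (ReducedWord ι →₀ ℝ) :=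
  Finsupp.linearCombination ℝ fun w =>
    Finsupp.mapDomain (setHead i w) ((b i).repr (q * b i (headExp i w)))

lemma leftMul_single (b : ι → Module.Basis ℕ ℝ ℝ[X]) (i : ι) (q : ℝ[X]) (w : ReducedWord ι)
    (c : ℝ) : leftMul b i q (Finsupp.single w c) =
      c • Finsupp.mapDomain (setHead i w) ((b i).repr (q * b i (headExp i w))) := by
  rw [leftMul, Finsupp.linearCombination_single]

/-- Every word factors as a leading `i`-block, of exponent 0 if absent, times a tail. Since `b i 0 =
1`, an absent block is the polynomial 1, so multiplying the block by `q` and expanding in the basis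
`b i` is exact in the algebra. -/
lemma evalLin_leftMul {b : ι → Module.Basis ℕ ℝ ℝ[X]} (hb : ∀ i, b i 0 = 1) {a : ι → A}
    {x : ι → ℕ → A} (hxb : ∀ i n, x i n = aeval (a i) (b i n)) (i : ι) (q : ℝ[X])
    (v : ReducedWord ι →₀ ℝ) :
    evalLin x (leftMul b i q v) = aeval (a i) q * evalLin x v := by
  have hx : ∀ i, x i 0 = 1 := fun i => by simp [hxb, hb]
  induction v using Finsupp.induction_linear with
  | zero => simp
  | add u v hu hv => simp only [map_add, hu, hv, mul_add]
  | single w c =>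
    have key : evalLin x
        (Finsupp.mapDomain (setHead i w) ((b i).repr (q * b i (headExp i w)))) =
        aeval (a i) q * eval x w := by
      rw [evalLin, Finsupp.linearCombination_mapDomain, Finsupp.linearCombination_apply,
        eval_eq hx i w, hxb, ← mul_assoc, ← map_mul]
      conv_rhs => rw [← (b i).linearCombination_repr (q * b i (headExp i w)),
        Finsupp.linearCombination_apply, Finsupp.sum, map_sum, Finset.sum_mul]
      refine Finset.sum_congr rfl fun n _ => ?_
      change _ • eval x (setHead i w n) = _
      rw [eval_setHead hx, map_smul, smul_mul_assoc, hxb]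
    rw [leftMul_single, map_smul, key]
    simp [evalLin]

lemma repr_eq_integral {μ : Measure ℝ} (hi : ∀ n : ℕ, Integrable (fun x : ℝ => x ^ n) μ)
    {b : Module.Basis ℕ ℝ ℝ[X]}
    (hb : ∀ m n, ∫ x, (b m).eval x * (b n).eval x ∂μ = if m = n then 1 else 0) (q : ℝ[X]) (n : ℕ) :
    b.repr q n = ∫ x, q.eval x * (b n).eval x ∂μ := by
  conv_rhs => rw [← b.linearCombination_repr q, Finsupp.linearCombination_apply, Finsupp.sum]
  simp only [eval_finsetSum, eval_smul, smul_eq_mul, Finset.sum_mul, mul_assoc]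
  rw [integral_finsetSum]
  · simp only [integral_const_mul, hb]
    simp
  · intro m _
    have := (integrable_eval_of_integrable_pow hi (b m * b n)).const_mul (b.repr q m)
    simpa only [eval_mul] using this

/-- These matrix coefficients are unchanged when `w` and `w'` are exchanged, which is the symmetry
of the operator. -/
lemma leftMul_single_apply {μ : ι → Measure ℝ}
    (hi : ∀ i, ∀ n : ℕ, Integrable (fun x : ℝ => x ^ n) (μ i)) {b : ι → Module.Basis ℕ ℝ ℝ[X]}
    (hb : ∀ i m n, ∫ x, (b i m).eval x * (b i n).eval x ∂(μ i) = if m = n then 1 else 0) (i : ι)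
    (q : ℝ[X]) (w w' : ReducedWord ι) :
    leftMul b i q (Finsupp.single w 1) w' =
      if (equivPair i w).tail = (equivPair i w').tail then
        ∫ x, q.eval x * (b i (headExp i w)).eval x * (b i (headExp i w')).eval x ∂(μ i) else 0 := by
  rw [leftMul_single, one_smul]
  split_ifs with h
  · conv_lhs => rw [← setHead_headExp i h, Finsupp.mapDomain_apply (setHead_injective i w),
      repr_eq_integral (hi i) (hb i)]
    simp only [eval_mul]
  · refine Finsupp.mapDomain_of_notMem_range _ _ fun ⟨n, hn⟩ => h ?_
    rw [← hn, equivPair_setHead]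

end ReducedWord

namespace ReducedWord

open Monoid.CoprodI.Word

variable {ι : Type*} {A : Type*} [Ring A] [Algebra ℂ A] {φ : A →ₗ[ℂ] ℂ}

lemma isAlternatingCentered_letters {S : ι → Subalgebra ℂ A} {x : ι → ℕ → A}
    (hmem : ∀ i n, x i n ∈ S i) (hcent : ∀ i n, n ≠ 0 → φ (x i n) = 0) (w : ReducedWord ι) :
    IsAlternatingCentered φ S (letters x w) := by
  refine ⟨?_, ?_, ?_⟩
  · intro s hs
    obtain ⟨t, -, rfl⟩ := List.mem_map.1 hs
    exact hmem _ _
  · intro s hs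
    obtain ⟨t, ht, rfl⟩ := List.mem_map.1 hs
    exact hcent _ _ fun h => w.ne_one t ht (toAdd_eq_zero.1 h)
  · rw [letters, List.isChain_map]
    exact w.chain_ne

/-- A nonempty word evaluates to an alternating product of centred elements, so only the coefficient
of the empty word survives. -/
lemma apply_evalLin {S : ι → Subalgebra ℂ A} (hfree : FreelyIndependentSubalgebras φ S)
    (hφ : φ 1 = 1) {x : ι → ℕ → A} (hmem : ∀ i n, x i n ∈ S i)
    (hcent : ∀ i n, n ≠ 0 → φ (x i n) = 0) (v : ReducedWord ι →₀ ℝ) :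
    φ (evalLin x v) = (v empty : ℂ) := by
  classical
  induction v using Finsupp.induction_linear with
  | zero => simp
  | add u v hu hv => simp [hu, hv]
  | single w c =>
    have hs : evalLin x (Finsupp.single w c) = (c : ℂ) • eval x w := by
      simp [evalLin]
    rw [hs, map_smul, Finsupp.single_apply]
    split_ifs with hw
    · subst hw
      simp [eval, empty, hφ]
    · rw [← prod_letters, hfree.apply_prod_eq_zero (isAlternatingCentered_letters hmem hcent w)]
      · simp
      · intro h
        refine hw (Monoid.CoprodI.Word.ext ?_)
        simpa [letters] using h

lemma apply_mul_evalLin_comm {S : ι → Subalgebra ℂ A} (hfree : FreelyIndependentSubalgebras φ S)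
    (hφ : φ 1 = 1) (hcomm : ∀ i, ∀ x ∈ S i, ∀ y ∈ S i, x * y = y * x) {x : ι → ℕ → A}
    (hmem : ∀ i n, x i n ∈ S i) (hcent : ∀ i n, n ≠ 0 → φ (x i n) = 0) (v : ReducedWord ι →₀ ℝ)
    {i : ι} {y : A} (hy : y ∈ S i) :
    φ (y * evalLin x v) = φ (evalLin x v * y) := by
  induction v using Finsupp.induction_linear with
  | zero => simp
  | add u v hu hv => simp only [map_add, mul_add, add_mul, hu, hv]
  | single w c =>
    have hs : evalLin x (Finsupp.single w c) = (c : ℂ) • eval x w := by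
      simp [evalLin]
    rw [hs, mul_smul_comm, smul_mul_assoc, map_smul, map_smul, ← prod_letters,
      hfree.apply_mul_comm hφ hcomm (isAlternatingCentered_letters hmem hcent w) hy]

end ReducedWord

/-! ### The symmetric model and the main theorem -/

/-- The free product of multiplication operators: freely independent variables whose spectral
distributions are not compactly supported are modelled by symmetric operators. -/
theorem FreelyIndependent.exists_symmetric_model {A : Type*} [Ring A] [Algebra ℂ A]
    {φ : A →ₗ[ℂ] ℂ} (hφ : φ 1 = 1) {ι : Type} {a : ι → A} (hfree : FreelyIndependent φ a)
    {μ : ι → Measure ℝ} (hμ : ∀ i, IsSpectralDistribution φ (a i) (μ i))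
    (hnc : ∀ i, ¬ IsCompact (μ i).support) :
    ∃ (V : Type) (_ : NormedAddCommGroup V) (_ : InnerProductSpace ℝ V)
      (L : ι → ℝ[X] → V →ₗ[ℝ] V) (e : V) (Φ : V →ₗ[ℝ] A),
      ‖e‖ = 1 ∧ (∀ i q, (L i q).IsSymmetric) ∧ Φ e = 1 ∧
      (∀ i (q : ℝ[X]) v, Φ (L i q v) = aeval (a i) q * Φ v) ∧
      (∀ v, φ (Φ v) = (⟪v, e⟫_ℝ : ℂ)) ∧
      ∀ i (q : ℝ[X]) v, φ (aeval (a i) q * Φ v) = φ (Φ v * aeval (a i) q) := by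
  classical
  have hb : ∀ i, ∃ b : Module.Basis ℕ ℝ ℝ[X], b 0 = 1 ∧
      ∀ m n, ∫ x, (b m).eval x * (b n).eval x ∂(μ i) = if m = n then 1 else 0 := fun i =>
    have := (hμ i).isProbabilityMeasure
    exists_orthonormal_polynomial_basis (hμ i).integrable_pow (hnc i)
  choose b hb0 hb using hb
  have hi := fun i => (hμ i).integrable_pow
  let x : ι → ℕ → A := fun i n => aeval (a i) (b i n)
  have hmem : ∀ i n, x i n ∈ Algebra.adjoin ℂ {a i} := fun i n => aeval_real_mem_adjoin _ _
  -- Orthogonality of `b i n` to `b i 0 = 1` says exactly that the letter is centred.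
  have hcent : ∀ i n, n ≠ 0 → φ (x i n) = 0 := fun i n hn => by
    have := hb i n 0
    rw [if_neg hn] at this
    simp only [hb0, eval_one, mul_one] at this
    rw [(hμ i).apply_aeval, this, Complex.ofReal_zero]
  let core := Finsupp.innerProductCore (ReducedWord ι)
  let _ : NormedAddCommGroup (ReducedWord ι →₀ ℝ) := core.toNormedAddCommGroup
  let _ : InnerProductSpace ℝ (ReducedWord ι →₀ ℝ) := InnerProductSpace.ofCore core.toCore
  have hinner : ∀ u v : ReducedWord ι →₀ ℝ, ⟪u, v⟫_ℝ = u.sum fun w c => c * v w := fun _ _ => rfl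
  have hsingle : ∀ (u : ReducedWord ι →₀ ℝ) w, ⟪u, Finsupp.single w 1⟫_ℝ = u w := fun u w => by
    rw [real_inner_comm, hinner, Finsupp.sum_single_index (by simp), one_mul]
  refine ⟨ReducedWord ι →₀ ℝ, inferInstance, inferInstance, ReducedWord.leftMul b,
    Finsupp.single Monoid.CoprodI.Word.empty 1, ReducedWord.evalLin x, ?_, ?_, ?_,
    ReducedWord.evalLin_leftMul hb0 fun _ _ => rfl, ?_, ?_⟩
  · rw [← pow_eq_one_iff_of_nonneg (norm_nonneg _) two_ne_zero, ← real_inner_self_eq_norm_sq,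
      hsingle, Finsupp.single_eq_same]
  · intro i q u v
    induction u using Finsupp.induction_linear with
    | zero => simp
    | add u u' hu hu' => rw [map_add, inner_add_left, inner_add_left, hu, hu']
    | single w c =>
      induction v using Finsupp.induction_linear with
      | zero => simp
      | add v v' hv hv' => rw [map_add, inner_add_right, inner_add_right, hv, hv']
      | single w' c' =>
        rw [← mul_one c, ← mul_one c', ← smul_eq_mul, ← smul_eq_mul c', ← Finsupp.smul_single,
          ← Finsupp.smul_single, map_smul, map_smul, real_inner_smul_left, real_inner_smul_left,
          real_inner_smul_right, real_inner_smul_right, hsingle,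
          real_inner_comm _ (Finsupp.single w (1 : ℝ)), hsingle,
          ReducedWord.leftMul_single_apply hi hb, ReducedWord.leftMul_single_apply hi hb]
        simp only [eq_comm, mul_right_comm]
  · simp [ReducedWord.evalLin, ReducedWord.eval, Monoid.CoprodI.Word.empty]
  · intro v
    rw [ReducedWord.apply_evalLin hfree hφ hmem hcent, hsingle]
  · intro i q v
    exact ReducedWord.apply_mul_evalLin_comm hfree hφ
      (fun i x hx y hy => mul_comm_of_mem_adjoin_singleton hx hy) hmem hcent v
      (aeval_real_mem_adjoin _ _)

/-- Mixed moments of two free variables of the form `φ (q (a i) * a j)`. -/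
lemma FreelyIndependent.apply_aeval_mul {A : Type*} [Ring A] [Algebra ℂ A] {φ : A →ₗ[ℂ] ℂ}
    (hφ : φ 1 = 1) {ι : Type*} {a : ι → A} (hfree : FreelyIndependent φ a) {i j : ι} (hij : i ≠ j)
    (q : ℝ[X]) : φ (aeval (a i) q * a j) = φ (aeval (a i) q) * φ (a j) := by
  have hcent : ∀ z : A, φ (z - algebraMap ℂ A (φ z)) = 0 := fun z => by
    rw [map_sub, Algebra.algebraMap_eq_smul_one, map_smul, hφ]
    simp
  have hl : IsAlternatingCentered φ (fun i => Algebra.adjoin ℂ {a i})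
      [(j, a j - algebraMap ℂ A (φ (a j)))] :=
    ⟨fun s hs => by
      rw [List.mem_singleton.1 hs]
      exact Subalgebra.sub_mem _ (Algebra.self_mem_adjoin_singleton ℂ (a j))
        (Subalgebra.algebraMap_mem _ _),
    fun s hs => by rw [List.mem_singleton.1 hs]; exact hcent (a j), by simp⟩
  have h := FreelyIndependentSubalgebras.apply_mul_prod_eq_zero hfree hφ hl (by simp)
    (aeval_real_mem_adjoin (a i) q) (by simpa using hij)
  simp only [List.map_cons, List.map_nil, List.prod_singleton, mul_sub, map_sub] at h
  rw [← Algebra.commutes, ← Algebra.smul_def, map_smul, sub_eq_zero] at h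
  rw [h, smul_eq_mul, mul_comm]

theorem mainTheorem1 {A : Type*} [Ring A] [Algebra ℂ A] (φ : A →ₗ[ℂ] ℂ) (hφ : φ 1 = 1)
    (d : ℕ) (hd : 1 ≤ d) (a : Fin d → A) (hfree : FreelyIndependent φ a)
    (μ : Fin d → Measure ℝ) (hμ : ∀ i, IsSpectralDistribution φ (a i) (μ i))
    (hnc : ∀ i, ¬ IsCompact (μ i).support) :
    (∃ ν : Measure ℝ, IsSpectralDistribution φ (∑ i, a i) ν) ∧
      ∀ ν : Measure ℝ, IsSpectralDistribution φ (∑ i, a i) ν → ¬ IsCompact ν.support := by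
  obtain ⟨V, _, _, L, e, Φ, he, hsymm, hΦe, hΦL, hφΦ, htrace⟩ :=
    hfree.exists_symmetric_model hφ hμ hnc
  let J : V →ₗ[ℝ] V := ∑ i, L i X
  have hJ : J.IsSymmetric := fun u v => by
    simp only [J, LinearMap.sum_apply, sum_inner, inner_sum]
    exact Finset.sum_congr rfl fun i _ => hsymm i X u v
  have hΦJ : ∀ v, Φ (J v) = (∑ i, a i) * Φ v := fun v => by
    simp only [J, LinearMap.sum_apply, map_sum, hΦL, aeval_X, Finset.sum_mul]
  have hΦpow : ∀ (n : ℕ) v, Φ ((J ^ n) v) = (∑ i, a i) ^ n * Φ v := fun n v => by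
    induction n with
    | zero => simp
    | succ n ih => rw [pow_succ', Module.End.mul_apply, hΦJ, ih, pow_succ', mul_assoc]
  have hmoment : ∀ n : ℕ, φ ((∑ i, a i) ^ n) = (⟪(J ^ n) e, e⟫_ℝ : ℂ) := fun n => by
    rw [← hφΦ, hΦpow, hΦe, mul_one]
  constructor
  · obtain ⟨ν, hp, hi, hm⟩ := hJ.exists_measure_moments e he
    exact ⟨ν, hp, hi, fun n => by rw [hmoment, hm]⟩
  intro ν hν hcompact
  have := hν.isProbabilityMeasure
  obtain ⟨M, hM, hMn⟩ := exists_abs_moment_le_of_isCompact_support hcompact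
  have hJn : ∀ n : ℕ, ⟪(J ^ n) e, e⟫_ℝ ≤ M ^ n := fun n => by
    have : ⟪(J ^ n) e, e⟫_ℝ = ∫ x, x ^ n ∂ν := by
      exact_mod_cast (hmoment n).symm.trans (hν.moment_eq n)
    rw [this]
    exact (le_abs_self _).trans (hMn n)
  let i₀ : Fin d := ⟨0, hd⟩
  have hpow_symm : ∀ (n : ℕ) u v, ⟪(J ^ n) u, v⟫_ℝ = ⟪u, (J ^ n) v⟫_ℝ := fun n => hJ.pow n
  -- Traciality moves both polynomials to the same side of the power, so that only their product
  -- matters.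
  have hsplit : ∀ (p q : ℝ[X]) (n : ℕ), (⟪(J ^ n) (L i₀ p e), L i₀ q e⟫_ℝ : ℂ) =
      φ (aeval (a i₀) (p * q) * (∑ i, a i) ^ n) := fun p q n => by
    rw [← hsymm i₀ q, ← hφΦ, hΦL, htrace, hΦpow, hΦL, hΦe, mul_one, mul_assoc, ← map_mul,
      ← mul_one ((∑ i, a i) ^ n), ← hΦe, ← hΦpow, htrace]
  have hsplit' : ∀ (q : ℝ[X]) (n : ℕ), (⟪(J ^ n) e, L i₀ q e⟫_ℝ : ℂ) =
      φ (aeval (a i₀) q * (∑ i, a i) ^ n) := fun q n => by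
    rw [← hsymm i₀ q, ← hφΦ, hΦL, hΦpow, hΦe, mul_one]
  -- Here ‖Jⁿ p(a_1)e‖² = ⟪J^(2n)e, p²(a_1)e⟫, and Cauchy–Schwarz with ‖J^(2n)e‖ ≤ M^(2n) gives the
  -- constant ‖p²(a_1)e‖.
  have hbound : ∀ p : ℝ[X], ‖J (L i₀ p e)‖ ≤ M * ‖L i₀ p e‖ := fun p => by
    refine hJ.norm_apply_le_of_pow_growth _ (C := ‖L i₀ (p * p) e‖) hM fun n => ?_
    have h1 : ‖(J ^ n) (L i₀ p e)‖ ^ 2 = ⟪(J ^ (2 * n)) e, L i₀ (p * p) e⟫_ℝ := by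
      have : (⟪(J ^ (2 * n)) (L i₀ p e), L i₀ p e⟫_ℝ : ℂ) =
        (⟪(J ^ (2 * n)) e, L i₀ (p * p) e⟫_ℝ : ℂ) := by rw [hsplit, hsplit']
      rw [← Complex.ofReal_injective this, two_mul, pow_add, Module.End.mul_apply, hpow_symm,
        real_inner_self_eq_norm_sq]
    have h2 : ‖(J ^ (2 * n)) e‖ ≤ M ^ (2 * n) := by
      refine le_of_sq_le_sq ?_ (by positivity)
      rw [← real_inner_self_eq_norm_sq, ← hpow_symm, ← Module.End.mul_apply, ← pow_add,
        ← pow_mul, mul_two]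
      exact hJn _
    rw [h1, mul_comm ‖_‖]
    exact (real_inner_le_norm _ _).trans (mul_le_mul_of_nonneg_right h2 (norm_nonneg _))
  -- By freeness each other variable acts as its mean when paired with polynomials in `a i₀`, so the
  -- whole sum acts as x + c.
  let c : ℝ := ∑ i ∈ Finset.univ.erase i₀, ∫ x, x ∂(μ i)
  have hφa : ∀ r : ℝ[X], φ (aeval (a i₀) r * ∑ i, a i) =
      ((∫ x, (r * (X + C c)).eval x ∂(μ i₀) : ℝ) : ℂ) := fun r => by
    rw [← (hμ i₀).apply_aeval, Finset.mul_sum, map_sum,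
      ← Finset.add_sum_erase _ _ (Finset.mem_univ i₀)]
    have hother : ∀ i ∈ Finset.univ.erase i₀, φ (aeval (a i₀) r * a i) =
        φ (aeval (a i₀) r) * ((∫ x, x ∂(μ i) : ℝ) : ℂ) := fun i hi => by
      rw [hfree.apply_aeval_mul hφ (Finset.ne_of_mem_erase hi).symm]
      simpa using congrArg (φ (aeval (a i₀) r) * ·) ((hμ i).moment_eq 1)
    rw [Finset.sum_congr rfl hother, ← Finset.mul_sum, ← Complex.ofReal_sum, map_mul (aeval (a i₀)),
      map_add (aeval (a i₀)), aeval_X, aeval_C, mul_add, map_add φ, ← Algebra.commutes, ← Algebra.smul_def,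
      ← Complex.coe_smul, map_smul, smul_eq_mul, mul_comm (φ _)]
  have hinner : ∀ p q : ℝ[X], ⟪L i₀ p e, L i₀ q e⟫_ℝ = ∫ x, (p * q).eval x ∂(μ i₀) :=
    fun p q => by
      have := hsplit p q 0
      rw [pow_zero, pow_zero, mul_one, Module.End.one_apply, (hμ i₀).apply_aeval] at this
      exact_mod_cast this
  let s : ℕ → ℝ := fun n => ∫ x, (x + c) ^ (2 * n) ∂(μ i₀)
  have hnorm : ∀ n : ℕ, ‖L i₀ ((X + C c) ^ n) e‖ ^ 2 = s n := fun n => by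
    rw [← real_inner_self_eq_norm_sq, hinner]
    simp only [s, eval_mul, eval_pow, eval_add, eval_X, eval_C, two_mul, pow_add]
  -- ‖(x + c)^(n+1)‖² is the pairing of J(x + c)^n with (x + c)^(n+1); Cauchy–Schwarz and `hbound`
  -- allow one factor to be cancelled.
  have hstep : ∀ n : ℕ, ‖L i₀ ((X + C c) ^ (n + 1)) e‖ ≤ M * ‖L i₀ ((X + C c) ^ n) e‖ :=
    fun n => by
      have h1 : ‖L i₀ ((X + C c) ^ (n + 1)) e‖ ^ 2 =
          ⟪J (L i₀ ((X + C c) ^ n) e), L i₀ ((X + C c) ^ (n + 1)) e⟫_ℝ := by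
        have := hsplit ((X + C c) ^ n) ((X + C c) ^ (n + 1)) 1
        rw [pow_one, pow_one, hφa] at this
        rw [Complex.ofReal_injective this, ← real_inner_self_eq_norm_sq, hinner]
        congr 1
        ext x
        congr 1
        ring
      have h2 := (real_inner_le_norm (J (L i₀ ((X + C c) ^ n) e))
        (L i₀ ((X + C c) ^ (n + 1)) e)).trans
        (mul_le_mul_of_nonneg_right (hbound _) (norm_nonneg _))
      rw [← h1, pow_two] at h2
      rcases (norm_nonneg (L i₀ ((X + C c) ^ (n + 1)) e)).eq_or_lt with h0 | h0
      · rw [← h0]; positivity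
      · exact le_of_mul_le_mul_right h2 h0
  have hp := (hμ i₀).isProbabilityMeasure
  have hgrow : ∀ n : ℕ, ‖L i₀ ((X + C c) ^ n) e‖ ≤ M ^ n := fun n => by
    induction n with
    | zero =>
      have : ‖L i₀ ((X + C c) ^ 0) e‖ ^ 2 = 1 := by rw [hnorm]; simp [s]
      simpa using ((pow_eq_one_iff_of_nonneg (norm_nonneg _) two_ne_zero).1 this).le
    | succ n ih =>
      rw [pow_succ' M]
      exact (hstep n).trans (mul_le_mul_of_nonneg_left ih hM.le)
  refine hnc i₀ (isCompact_support_of_even_moment_le (c := c) hM (fun n => ?_) fun n => ?_)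
  · refine (integrable_eval_of_integrable_pow (hμ i₀).integrable_pow
      ((X + C c) ^ (2 * n))).congr (ae_of_all _ fun x => ?_)
    simp only [eval_pow, eval_add, eval_X, eval_C]
  · rw [mul_comm 2 n, pow_mul M, ← mul_comm 2 n]
    exact (hnorm n).symm.le.trans (pow_le_pow_left₀ (norm_nonneg _) (hgrow n) 2)
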